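/- Let $X$ be a Banach space over $\mathbb K\in\{\mathbb R,\mathbb C\}$ with topological dual $X^*$, and let $B_{X^*}$ be the closed unit ball of $X^*$. Let $G$ be a group of linear isometric isomorphisms of $X$ onto itself which is compact in the operator-norm topology of $\mathcal L(X)$, and let $X_G=\{x\in X : g(x)=x \text{ for all } g\in G\}$. Let $w^*_G$ be the topology on $X^*$ generated by the sets $$\{f\in X^* : \operatorname{Re}\langle f-f_0,x_i\rangle<\varepsilon,\ 1\le i\le n\},\qquad f_0\in X^*,\ x_1,\dots,x_n\in X_G,\ \varepsilon>0.$$ Let $C\subseteq X^*$ be convex and $G^*$-invariant, i.e. $g^*(C)=C$ for every $g\in G$, where $g^*f=f\circ g$. If $\delta B_{X^*}\cap C$ is $w^*_G$-closed in $X^*$ for every $\delta>0$, then $C$ is $w^*_G$-closed in $X^*$. More generally, the same conclusion holds if, for every $\delta>0$, $\delta B_{X^*}\cap C$ is only relatively $w^*_G$-closed in $\delta B_{X^*}$, i.e. $\delta B_{X^*}\cap C=\delta B_{X^*}\cap F$ for some $w^*_G$-closed set $F\subseteq X^*$. -/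

import Mathlib

open scoped Topology

namespace GInv

section

variable {𝕜 : Type*} [RCLike 𝕜] {X : Type*} [NormedAddCommGroup X] [NormedSpace 𝕜 X]

/-- The group `G` of linear isometric isomorphisms of `X` is compact for the relative topology
of `𝓛(X)`, i.e. its set of operators is compact in the operator norm topology. -/
def IsCompactGroup (G : Subgroup (X ≃ₗᵢ[𝕜] X)) : Prop :=
  IsCompact {T : X →L[𝕜] X | ∃ g ∈ G, T = (g.toContinuousLinearEquiv : X →L[𝕜] X)}

/-- `X_G`, the set of `G`-invariant points of `X`. -/
def fixedPoints (G : Subgroup (X ≃ₗᵢ[𝕜] X)) : Set X :=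
  {x | ∀ g ∈ G, g x = x}

/-- The adjoint `g^* : X^* → X^*`, `g^* f = f ∘ g`. -/
def adj (g : X ≃ₗᵢ[𝕜] X) (f : StrongDual 𝕜 X) : StrongDual 𝕜 X :=
  f.comp (g.toContinuousLinearEquiv : X →L[𝕜] X)

/-- `C ⊆ X^*` is `G^*`-invariant: `g^*(C) = C` for every `g ∈ G`. -/
def IsDualInvariant (G : Subgroup (X ≃ₗᵢ[𝕜] X)) (C : Set (StrongDual 𝕜 X)) : Prop :=
  ∀ g ∈ G, adj g '' C = C

/-- The basic set `{f | Re ⟨f - f₀, x⟩ < ε for all x ∈ s}` (over `ℝ`, `Re` is the identity). -/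
def basicSet (f₀ : StrongDual 𝕜 X) (s : Finset X) (ε : ℝ) : Set (StrongDual 𝕜 X) :=
  {f | ∀ x ∈ s, RCLike.re ((f - f₀) x) < ε}

/-- The group invariant weak-star topology `w^*_G` on `X^*`, generated by the basic sets
with `f₀ ∈ X^*`, finitely many points of `X_G`, and `ε > 0`. -/
@[reducible] def weakStarG (G : Subgroup (X ≃ₗᵢ[𝕜] X)) : TopologicalSpace (StrongDual 𝕜 X) :=
  TopologicalSpace.generateFrom
    {U | ∃ (f₀ : StrongDual 𝕜 X) (s : Finset X) (ε : ℝ),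
      (s : Set X) ⊆ fixedPoints G ∧ 0 < ε ∧ U = basicSet f₀ s ε}

end

end GInv

/-!
Let `Z = X_G` and let `ρ : X^* → Z^*` be the restriction map. The topology `w^*_G` is the one
induced by `ρ` from the weak-star topology of `Z^*`. Two functionals with the same restriction to
`Z` are not separated by `w^*_G` and lie in a common ball, so the hypothesis forces `C = ρ⁻¹(ρ C)`;
and since functionals on `Z` extend to `X` with the same norm, the bounded parts of `ρ C` are
weak-star closed. By the Krein–Šmulian theorem `ρ C` is then weak-star closed, hence `C` is
`w^*_G`-closed.

For the Krein–Šmulian theorem, let `D ⊆ Y^*` be convex with weak-star closed bounded parts and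
`0 ∉ D`. Alaoglu's theorem gives, one ball at a time, a set `A ⊆ Y` tending to zero in norm whose
polar is disjoint from `D`. Then `f ↦ (f a)_{a ∈ A}` maps `D` off the open unit ball of `ℓ^∞(A)`,
and a functional on `ℓ^∞(A)` separating the two acts on null families through an `ℓ¹` family of
weights `c`, so it separates `D` from `0` through the vector `∑ c_a a` of `Y`.
-/

namespace GInv

open Filter Set WeakDual
open scoped ENNReal

section NullFamilies

variable {ι : Type*}

lemma hasSum_lpSingle_of_tendsto_cofinite {E : ι → Type*} [∀ i, NormedAddCommGroup (E i)]
    [DecidableEq ι] (a : lp E ∞) (ha : Tendsto (fun i => ‖a i‖) cofinite (𝓝 0)) :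
    HasSum (fun i => lp.single ∞ i (a i)) a := by
  rw [HasSum, SummationFilter.unconditional_filter, Metric.tendsto_nhds]
  intro ε hε
  have hfin : {i | ¬ ‖a i‖ < ε / 2}.Finite :=
    eventually_cofinite.1 (ha.eventually_lt_const (half_pos hε))
  filter_upwards [eventually_ge_atTop hfin.toFinset] with s hs
  rw [dist_comm, dist_eq_norm]
  refine (lp.norm_le_of_forall_le (half_pos hε).le fun i => ?_).trans_lt (half_lt_self hε)
  rw [lp.coeFn_sub, lp.coeFn_sum, Pi.sub_apply, Finset.sum_apply]
  simp only [lp.coeFn_single, Finset.sum_pi_single]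
  split_ifs with hi
  · simpa using (half_pos hε).le
  · rw [sub_zero]
    by_contra hlt
    exact hi (hs (hfin.mem_toFinset.2 fun h => hlt h.le))

lemma tendsto_cofinite_iUnion_finset {E : Type*} [SeminormedAddCommGroup E] {S : ℕ → Finset E}
    {b : ℕ → ℝ} (hb : Tendsto b atTop (𝓝 0)) (hS : ∀ n, ∀ x ∈ S (n + 1), x ∈ S n ∨ ‖x‖ ≤ b n) :
    Tendsto ((↑) : ↥(⋃ n, (S n : Set E)) → E) cofinite (𝓝 0) := by
  rw [Metric.tendsto_nhds]
  intro ε hε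
  obtain ⟨N, hN⟩ := eventually_atTop.1 (hb.eventually_lt_const hε)
  have hsmall (n : ℕ) : ∀ x ∈ S n, x ∈ ⋃ k ≤ N, (S k : Set E) ∨ ‖x‖ < ε := by
    induction n with
    | zero => exact fun x hx => Or.inl (mem_iUnion₂.2 ⟨0, N.zero_le, hx⟩)
    | succ n ih =>
      intro x hx
      rcases le_or_gt (n + 1) N with hn | hn
      · exact Or.inl (mem_iUnion₂.2 ⟨n + 1, hn, hx⟩)
      · exact (hS n x hx).elim (ih x) fun h => Or.inr (h.trans_lt (hN n (Nat.lt_succ_iff.1 hn)))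
  have hfin : (⋃ k ≤ N, (S k : Set E)).Finite :=
    (finite_Iic N).biUnion fun k _ => (S k).finite_toSet
  refine eventually_cofinite.2 ((hfin.preimage Subtype.val_injective.injOn).subset ?_)
  rintro ⟨x, hx⟩ hxε
  obtain ⟨n, hn⟩ := mem_iUnion.1 hx
  exact (hsmall n x hn).resolve_right fun h => hxε (by rwa [dist_zero_right])

variable {𝕜 : Type*} [RCLike 𝕜]

lemma summable_norm_apply_lpSingle [DecidableEq ι] (φ : StrongDual 𝕜 (lp (fun _ : ι => 𝕜) ∞)) :
    Summable fun i => ‖φ (lp.single ∞ i 1)‖ := by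
  refine summable_of_sum_le (c := ‖φ‖) (fun _ => norm_nonneg _) fun s => ?_
  choose c hc hφ using fun i => RCLike.exists_norm_eq_mul_self (φ (lp.single ∞ i 1))
  set a : lp (fun _ : ι => 𝕜) ∞ := ∑ i ∈ s, c i • lp.single ∞ i 1
  have hφa : φ a = ((∑ i ∈ s, ‖φ (lp.single ∞ i 1)‖ : ℝ) : 𝕜) := by
    simp only [a, map_sum, map_smul, smul_eq_mul, hφ]
  have ha : ‖a‖ ≤ 1 := by
    refine lp.norm_le_of_forall_le zero_le_one fun i => ?_
    have hai : a i = if i ∈ s then c i else 0 := by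
      simp only [a, ← lp.single_smul, smul_eq_mul, mul_one, lp.coeFn_sum, Finset.sum_apply,
        lp.coeFn_single, Finset.sum_pi_single]
    rw [hai]
    split_ifs
    · exact (hc i).le
    · simp
  calc ∑ i ∈ s, ‖φ (lp.single ∞ i 1)‖ = ‖φ a‖ := by
        rw [hφa, RCLike.norm_of_nonneg (Finset.sum_nonneg fun _ _ => norm_nonneg _)]
    _ ≤ ‖φ‖ := φ.le_of_opNorm_le_of_le le_rfl ha |>.trans_eq (mul_one _)

variable {Y : Type*} [NormedAddCommGroup Y] [NormedSpace 𝕜 Y]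

variable (𝕜) in
/-- Evaluation of functionals on `Y` along a family of vectors tending to zero, as a linear map into
`ℓ^∞`, where Hahn–Banach separation from the open unit ball is available. -/
noncomputable def evalNull {v : ι → Y} (hv : Tendsto v cofinite (𝓝 0)) :
    StrongDual 𝕜 Y →ₗ[𝕜] lp (fun _ : ι => 𝕜) ∞ where
  toFun f := ⟨fun i => f (v i),
    memℓp_infty ((f.continuous.norm.tendsto 0).comp hv).bddAbove_range_of_cofinite⟩
  map_add' _ _ := rfl
  map_smul' _ _ := rfl

@[simp]
lemma evalNull_apply {v : ι → Y} (hv : Tendsto v cofinite (𝓝 0)) (f : StrongDual 𝕜 Y) (i : ι) :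
    evalNull 𝕜 hv f i = f (v i) := rfl

lemma exists_apply_evalNull_eq [CompleteSpace Y] {v : ι → Y} (hv : Tendsto v cofinite (𝓝 0))
    (φ : StrongDual 𝕜 (lp (fun _ : ι => 𝕜) ∞)) :
    ∃ y : Y, ∀ f : StrongDual 𝕜 Y, φ (evalNull 𝕜 hv f) = f y := by
  classical
  obtain ⟨M, hM⟩ := (hv.norm).bddAbove_range_of_cofinite
  have hsum : Summable fun i => φ (lp.single ∞ i 1) • v i :=
    .of_norm_bounded ((summable_norm_apply_lpSingle φ).mul_right M) fun i => by
      rw [norm_smul]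
      gcongr
      exact hM ⟨i, rfl⟩
  refine ⟨∑' i, φ (lp.single ∞ i 1) • v i, fun f => ?_⟩
  have hnull : Tendsto (fun i => ‖evalNull 𝕜 hv f i‖) cofinite (𝓝 0) := by
    simpa [Function.comp_def] using (f.continuous.norm.tendsto 0).comp hv
  have hsingle (i : ι) : φ (lp.single ∞ i (evalNull 𝕜 hv f i)) =
      f (φ (lp.single ∞ i 1) • v i) := by
    rw [evalNull_apply, ← mul_one (f (v i)), ← smul_eq_mul, lp.single_smul, map_smul, map_smul,
      smul_eq_mul, smul_eq_mul, mul_comm]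
  calc φ (evalNull 𝕜 hv f) = ∑' i, φ (lp.single ∞ i (evalNull 𝕜 hv f i)) :=
        ((hasSum_lpSingle_of_tendsto_cofinite _ hnull).mapL φ).tsum_eq.symm
    _ = ∑' i, f (φ (lp.single ∞ i 1) • v i) := tsum_congr hsingle
    _ = f (∑' i, φ (lp.single ∞ i 1) • v i) := (f.map_tsum hsum).symm

lemma exists_one_le_re_of_null_family [CompleteSpace Y] {v : ι → Y}
    (hv : Tendsto v cofinite (𝓝 0)) {D : Set (StrongDual 𝕜 Y)} (hD : Convex ℝ D)
    (hDv : Disjoint D (StrongDual.polar 𝕜 (range v))) :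
    ∃ y : Y, ∀ f ∈ D, 1 ≤ RCLike.re (f y) := by
  have hconv : Convex ℝ (evalNull 𝕜 hv '' D) :=
    hD.is_linear_image ⟨map_add _, fun _ _ => lp.ext rfl⟩
  have hdisj : Disjoint (Metric.ball 0 1) (evalNull 𝕜 hv '' D) := by
    rw [Set.disjoint_right]
    rintro _ ⟨f, hf, rfl⟩ hball
    refine Set.disjoint_left.1 hDv hf (forall_mem_range.2 fun i => ?_)
    exact (lp.norm_apply_le_norm ENNReal.top_ne_zero (evalNull 𝕜 hv f) i).trans
      (mem_ball_zero_iff.1 hball).le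
  obtain ⟨φ, u, hφ, hu⟩ := RCLike.geometric_hahn_banach_open (𝕜 := 𝕜)
    (convex_ball 0 1) Metric.isOpen_ball hconv hdisj
  have hu₀ : 0 < u := by simpa using hφ 0 (Metric.mem_ball_self one_pos)
  obtain ⟨y, hy⟩ := exists_apply_evalNull_eq hv φ
  refine ⟨((u⁻¹ : ℝ) : 𝕜) • y, fun f hf => ?_⟩
  rw [map_smul, smul_eq_mul, RCLike.re_ofReal_mul, ← hy, ← inv_mul_cancel₀ hu₀.ne']
  gcongr
  exact hu _ ⟨f, hf, rfl⟩

end NullFamilies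

section KreinSmulian

variable {𝕜 : Type*} [RCLike 𝕜] {Y : Type*} [NormedAddCommGroup Y] [NormedSpace 𝕜 Y]
  {D : Set (StrongDual 𝕜 Y)}

lemma exists_finset_disjoint_polar {K : Set (WeakDual 𝕜 Y)} (hK : IsCompact K) {s : Set Y}
    (hs : Disjoint K (polar 𝕜 s)) :
    ∃ F : Finset Y, (F : Set Y) ⊆ s ∧ Disjoint K (polar 𝕜 (F : Set Y)) := by
  classical
  have hinter : ⋂ x : s, polar 𝕜 {(x : Y)} ⊆ polar 𝕜 s :=
    fun f hf x hx => mem_iInter.1 hf ⟨x, hx⟩ x rfl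
  obtain ⟨t, ht⟩ := hK.elim_finite_subfamily_closed (fun x : s => polar 𝕜 {(x : Y)})
    (fun x => isClosed_polar 𝕜 _) (hs.mono_right hinter).inter_eq
  refine ⟨t.image (↑), by simp, Disjoint.mono_right ?_ (Set.disjoint_iff_inter_eq_empty.2 ht)⟩
  refine fun f hf => mem_iInter₂.2 fun x hx => ?_
  rintro _ rfl
  exact hf x (by simpa using hx)

/-- Closedness for the bounded weak-star topology of `Y^*`: the intersections with the norm balls
centred at `0` are weak-star closed. -/
def IsBoundedWeakStarClosed (D : Set (StrongDual 𝕜 Y)) : Prop :=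
  ∀ δ : ℝ, 0 < δ → IsClosed (toStrongDual ⁻¹' (Metric.closedBall 0 δ ∩ D))

namespace IsBoundedWeakStarClosed

lemma isCompact_inter_closedBall (hD : IsBoundedWeakStarClosed D) {δ : ℝ} (hδ : 0 < δ) :
    IsCompact (toStrongDual ⁻¹' (Metric.closedBall 0 δ ∩ D)) :=
  (WeakDual.isCompact_closedBall 0 δ).of_isClosed_subset (hD δ hδ) inter_subset_left

lemma preimage_add_right (hD : IsBoundedWeakStarClosed D) (f₀ : StrongDual 𝕜 Y) :
    IsBoundedWeakStarClosed ((· + f₀) ⁻¹' D) := by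
  intro δ hδ
  have hclosed := (WeakDual.isClosed_closedBall (0 : StrongDual 𝕜 Y) δ).inter
    ((hD (δ + ‖f₀‖) (by positivity)).preimage
      (continuous_add_const (StrongDual.toWeakDual f₀)))
  convert hclosed using 1
  ext f
  simp only [mem_inter_iff, mem_preimage, mem_closedBall_zero_iff, map_add]
  exact and_congr_right fun hf => (and_iff_right (norm_add_le_of_le hf le_rfl)).symm

lemma exists_finset_disjoint_polar_union (hD : IsBoundedWeakStarClosed D) {r R : ℝ} (hr : 0 < r)
    (hR : 0 < R) {S : Set Y}
    (hS : Disjoint (Metric.closedBall 0 r ∩ D) (StrongDual.polar 𝕜 S)) :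
    ∃ F : Finset Y, (∀ x ∈ F, ‖x‖ ≤ r⁻¹) ∧
      Disjoint (Metric.closedBall 0 R ∩ D) (StrongDual.polar 𝕜 (S ∪ F)) := by
  have hpolar : polar 𝕜 (Metric.closedBall (0 : Y) r⁻¹) =
      toStrongDual ⁻¹' Metric.closedBall 0 r := by
    rw [WeakDual.polar, NormedSpace.polar_closedBall (inv_pos.2 hr), inv_inv]
  obtain ⟨F, hFr, hF⟩ := exists_finset_disjoint_polar
    (K := toStrongDual ⁻¹' (Metric.closedBall 0 R ∩ D) ∩ polar 𝕜 S)
    (s := Metric.closedBall 0 r⁻¹)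
    ((hD.isCompact_inter_closedBall hR).inter_right (isClosed_polar 𝕜 S)) (by
      rw [hpolar, Set.disjoint_left]
      rintro f ⟨⟨-, hfD⟩, hfS⟩ hfr
      exact Set.disjoint_left.1 hS ⟨hfr, hfD⟩ hfS)
  refine ⟨F, fun x hx => mem_closedBall_zero_iff.1 (hFr hx), Set.disjoint_left.2 ?_⟩
  intro f hfD hf
  have hfF := hF.notMem_of_mem_left (a := StrongDual.toWeakDual f)
    ⟨hfD, fun x hx => hf x (Or.inl hx)⟩
  exact hfF fun x hx => hf x (Or.inr hx)

lemma exists_seq_finset_disjoint_polar (hD : IsBoundedWeakStarClosed D) (h₀ : 0 ∉ D) :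
    ∃ S : ℕ → Finset Y, (∀ n, ∀ x ∈ S (n + 1), x ∈ S n ∨ ‖x‖ ≤ ((n : ℝ) + 1)⁻¹) ∧
      ∀ n : ℕ, Disjoint (Metric.closedBall 0 ((n : ℝ) + 1) ∩ D)
        (StrongDual.polar 𝕜 (S n : Set Y)) := by
  classical
  let P (n : ℕ) (S : Finset Y) : Prop :=
    Disjoint (Metric.closedBall 0 ((n : ℝ) + 1) ∩ D) (StrongDual.polar 𝕜 (S : Set Y))
  obtain ⟨S₀, -, hS₀⟩ := exists_finset_disjoint_polar (s := univ)
    (hD.isCompact_inter_closedBall (δ := (0 : ℕ) + 1) (by positivity)) (by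
      rw [WeakDual.polar, StrongDual.polar_univ, Set.disjoint_right]
      rintro f hf ⟨-, hfD⟩
      exact h₀ (toStrongDual.map_eq_zero_iff.1 hf ▸ hfD))
  have hstep (n : ℕ) (S : {S // P n S}) :
      ∃ T : {T // P (n + 1) T}, ∀ x ∈ T.1, x ∈ S.1 ∨ ‖x‖ ≤ ((n : ℝ) + 1)⁻¹ := by
    obtain ⟨F, hFn, hF⟩ := hD.exists_finset_disjoint_polar_union (by positivity)
      (R := (n + 1 : ℕ) + 1) (by positivity) S.2
    rw [← Finset.coe_union] at hF
    exact ⟨⟨S.1 ∪ F, hF⟩, fun x hx => (Finset.mem_union.1 hx).imp_right (hFn x)⟩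
  choose next hnext using hstep
  let S (n : ℕ) : {S // P n S} := Nat.rec ⟨S₀, hS₀⟩ next n
  exact ⟨fun n => (S n).1, fun n => hnext n (S n), fun n => (S n).2⟩

lemma exists_null_set_disjoint_polar (hD : IsBoundedWeakStarClosed D) (h₀ : 0 ∉ D) :
    ∃ A : Set Y, Tendsto ((↑) : A → Y) cofinite (𝓝 0) ∧
      Disjoint D (StrongDual.polar 𝕜 A) := by
  obtain ⟨S, hS, hSD⟩ := hD.exists_seq_finset_disjoint_polar h₀
  refine ⟨⋃ n, S n, tendsto_cofinite_iUnion_finset ?_ hS, Set.disjoint_left.2 fun f hfD hf => ?_⟩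
  · simpa only [one_div] using tendsto_one_div_add_atTop_nhds_zero_nat (𝕜 := ℝ)
  · obtain ⟨n, hn⟩ := exists_nat_ge ‖f‖
    refine Set.disjoint_left.1 (hSD n) ⟨?_, hfD⟩ fun x hx => hf x (mem_iUnion.2 ⟨n, hx⟩)
    exact mem_closedBall_zero_iff.2 (hn.trans (le_add_of_nonneg_right zero_le_one))

theorem isClosed_of_convex [CompleteSpace Y] (hD : IsBoundedWeakStarClosed D)
    (hconv : Convex ℝ D) : IsClosed (toStrongDual ⁻¹' D) := by
  rw [← isOpen_compl_iff, isOpen_iff_forall_mem_open]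
  intro f₀ hf₀
  obtain ⟨A, hA, hDA⟩ := (hD.preimage_add_right (toStrongDual f₀)).exists_null_set_disjoint_polar
    (by simpa using hf₀)
  obtain ⟨y, hy⟩ := exists_one_le_re_of_null_family hA
    (hconv.translate_preimage_left (toStrongDual f₀)) (by rwa [Subtype.range_coe])
  refine ⟨{f | RCLike.re (f y - f₀ y) < 1}, fun f hf hfD => ?_, ?_, by simp⟩
  · exact (hy (toStrongDual (f - f₀)) (by simpa using hfD)).not_gt hf
  · exact isOpen_lt (RCLike.continuous_re.comp
      ((eval_continuous y).sub continuous_const)) continuous_const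

end IsBoundedWeakStarClosed

end KreinSmulian

variable {𝕜 : Type*} [RCLike 𝕜] {X : Type*} [NormedAddCommGroup X] [NormedSpace 𝕜 X]

section Restriction

/-- The restriction map `X^* → Z^*` for a subspace `Z` of `X`. -/
noncomputable def restrictDual (Z : Submodule 𝕜 X) : StrongDual 𝕜 X →ₗ[𝕜] StrongDual 𝕜 Z where
  toFun f := f.comp Z.subtypeL
  map_add' _ _ := rfl
  map_smul' _ _ := rfl

/-- The topology on `X^*` of pointwise convergence on a subspace `Z` of `X`, encoded as the one
induced by restriction from the weak-star topology of `Z^*`. -/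
noncomputable abbrev weakStarOn (Z : Submodule 𝕜 X) : TopologicalSpace (StrongDual 𝕜 X) :=
  .induced (fun f => StrongDual.toWeakDual (restrictDual Z f)) inferInstance

variable {Z : Submodule 𝕜 X} {C : Set (StrongDual 𝕜 X)}

lemma exists_restrictDual_eq_norm_eq (d : StrongDual 𝕜 Z) :
    ∃ f, restrictDual Z f = d ∧ ‖f‖ = ‖d‖ := by
  obtain ⟨f, hfd, hf⟩ := exists_extension_norm_eq Z d
  exact ⟨f, ContinuousLinearMap.ext hfd, hf⟩

lemma mem_iff_mem_of_restrictDual_eq {F : Set (StrongDual 𝕜 X)} (hF : IsClosed[weakStarOn Z] F)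
    {f g : StrongDual 𝕜 X} (hfg : restrictDual Z f = restrictDual Z g) : f ∈ F ↔ g ∈ F := by
  obtain ⟨E, -, rfl⟩ := isClosed_induced_iff.1 hF
  rw [mem_preimage, mem_preimage, hfg]

lemma isClosed_closedBall_inter_image_restrictDual {F : Set (StrongDual 𝕜 X)} {δ : ℝ}
    (hF : IsClosed[weakStarOn Z] F)
    (hCF : Metric.closedBall 0 δ ∩ C = Metric.closedBall 0 δ ∩ F)
    (hsat : ∀ ⦃f g⦄, f ∈ C → restrictDual Z f = restrictDual Z g → g ∈ C) :
    IsClosed (toStrongDual ⁻¹' (Metric.closedBall 0 δ ∩ restrictDual Z '' C)) := by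
  obtain ⟨E, hE, rfl⟩ := isClosed_induced_iff.1 hF
  convert (WeakDual.isClosed_closedBall (0 : StrongDual 𝕜 Z) δ).inter hE using 1
  ext d
  refine and_congr_right fun hd => ?_
  obtain ⟨f, hfd, hf⟩ := exists_restrictDual_eq_norm_eq (toStrongDual d)
  have hfδ : f ∈ Metric.closedBall 0 δ := by simpa [hf] using hd
  have hfC : f ∈ C ↔ StrongDual.toWeakDual (restrictDual Z f) ∈ E := by
    simpa only [mem_inter_iff, hfδ, true_and, mem_preimage] using Set.ext_iff.1 hCF f
  change toStrongDual d ∈ _ ↔ StrongDual.toWeakDual (toStrongDual d) ∈ E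
  rw [← hfd, ← hfC]
  exact ⟨fun ⟨g, hg, hgf⟩ => hsat hg hgf, mem_image_of_mem _⟩

theorem isClosed_weakStarOn_of_convex [CompleteSpace Z] (hC : Convex ℝ C)
    (h : ∀ δ : ℝ, 0 < δ → ∃ F : Set (StrongDual 𝕜 X), IsClosed[weakStarOn Z] F ∧
      Metric.closedBall 0 δ ∩ C = Metric.closedBall 0 δ ∩ F) :
    IsClosed[weakStarOn Z] C := by
  have hsat ⦃f g : StrongDual 𝕜 X⦄ (hf : f ∈ C) (hfg : restrictDual Z f = restrictDual Z g) :
      g ∈ C := by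
    obtain ⟨F, hF, hCF⟩ := h (‖f‖ + ‖g‖ + 1) (by positivity)
    have hfF : f ∈ F := (hCF.subset ⟨mem_closedBall_zero_iff.2 (by
      linarith [norm_nonneg g]), hf⟩).2
    exact (hCF.superset ⟨mem_closedBall_zero_iff.2 (by linarith [norm_nonneg f]),
      (mem_iff_mem_of_restrictDual_eq hF hfg).1 hfF⟩).2
  have hbw : IsBoundedWeakStarClosed (restrictDual Z '' C) := by
    intro δ hδ
    obtain ⟨F, hF, hCF⟩ := h δ hδ
    exact isClosed_closedBall_inter_image_restrictDual hF hCF hsat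
  have hconv : Convex ℝ (restrictDual Z '' C) :=
    hC.is_linear_image ⟨map_add _, fun _ _ => rfl⟩
  refine isClosed_induced_iff.2 ⟨_, hbw.isClosed_of_convex hconv, ?_⟩
  refine Subset.antisymm ?_ fun f hf => mem_image_of_mem _ hf
  rintro g ⟨f, hf, hfg⟩
  exact hsat hf hfg

end Restriction

section FixedPoints

variable (G : Subgroup (X ≃ₗᵢ[𝕜] X))

lemma isClosed_fixedPoints : IsClosed (fixedPoints G) := by
  simp only [fixedPoints, ofPred_forall]
  exact isClosed_biInter fun g _ => isClosed_eq g.continuous continuous_id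

/-- The set `X_G` as a subspace of `X`. -/
def fixedSubmodule : Submodule 𝕜 X where
  carrier := fixedPoints G
  add_mem' hx hy g hg := by rw [map_add, hx g hg, hy g hg]
  zero_mem' g _ := map_zero g
  smul_mem' c x hx g hg := by rw [map_smul, hx g hg]

variable {G}

lemma isOpen_weakStarG_re_apply_lt {x : X} (hx : x ∈ fixedPoints G) (a : ℝ) :
    IsOpen[weakStarG G] {f : StrongDual 𝕜 X | RCLike.re (f x) < a} := by
  rcases eq_empty_or_nonempty {f : StrongDual 𝕜 X | RCLike.re (f x) < a} with h | ⟨f₀, hf₀⟩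
  · rw [h]
    exact @isOpen_empty _ (weakStarG G)
  · refine .basic _ ⟨f₀, {x}, a - RCLike.re (f₀ x), by simpa using hx, sub_pos.2 hf₀, ?_⟩
    ext f
    simp [basicSet]

lemma continuous_weakStarG_re_apply {x : X} (hx : x ∈ fixedPoints G) :
    Continuous[weakStarG G, inferInstance] fun f : StrongDual 𝕜 X => RCLike.re (f x) := by
  let := weakStarG G
  refine OrderTopology.continuous_iff.2 fun a => ⟨?_, isOpen_weakStarG_re_apply_lt hx a⟩
  have hneg : (fun f : StrongDual 𝕜 X => RCLike.re (f x)) ⁻¹' Ioi a =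
      {f | RCLike.re (f (-x)) < -a} := by
    ext f
    rw [mem_preimage, mem_Ioi, mem_ofPred_eq, map_neg, map_neg, neg_lt_neg_iff]
  rw [hneg]
  exact isOpen_weakStarG_re_apply_lt ((fixedSubmodule G).neg_mem hx) _

lemma continuous_weakStarG_apply {x : X} (hx : x ∈ fixedPoints G) :
    Continuous[weakStarG G, inferInstance] fun f : StrongDual 𝕜 X => f x := by
  let := weakStarG G
  have him (f : StrongDual 𝕜 X) :
      RCLike.re (f ((-RCLike.I : 𝕜) • x)) = RCLike.im (f x) := by simp
  have hdecomp (f : StrongDual 𝕜 X) : f x =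
      (RCLike.re (f x) : 𝕜) + (RCLike.re (f ((-RCLike.I : 𝕜) • x)) : 𝕜) * RCLike.I := by
    rw [him, RCLike.re_add_im]
  refine Continuous.congr ?_ fun f => (hdecomp f).symm
  exact (RCLike.continuous_ofReal.comp (continuous_weakStarG_re_apply hx)).add
    ((RCLike.continuous_ofReal.comp (continuous_weakStarG_re_apply
      ((fixedSubmodule G).smul_mem _ hx))).mul continuous_const)

variable (G)

theorem weakStarG_eq_weakStarOn :
    weakStarG G = weakStarOn (fixedSubmodule G) := by
  refine le_antisymm ?_ (le_generateFrom ?_)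
  · rw [← continuous_iff_le_induced]
    let := weakStarG G
    exact continuous_of_continuous_eval fun x => continuous_weakStarG_apply x.2
  · rintro _ ⟨f₀, s, ε, hs, -, rfl⟩
    refine isOpen_induced_iff.2 ⟨⋂ x : s, {d | RCLike.re (d ⟨x, hs x.2⟩ - f₀ x) < ε},
      isOpen_iInter_of_finite fun x => ?_, ?_⟩
    · exact isOpen_lt (RCLike.continuous_re.comp
        ((eval_continuous _).sub continuous_const)) continuous_const
    · ext f
      simp only [mem_preimage, mem_iInter, Subtype.forall]
      exact Iff.rfl

end FixedPoints

end GInv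

theorem mainTheorem5_general {𝕜 : Type*} [RCLike 𝕜] {X : Type*} [NormedAddCommGroup X]
    [NormedSpace 𝕜 X] (G : Subgroup (X ≃ₗᵢ[𝕜] X)) (hG : IsComplete (GInv.fixedPoints G))
    (C : Set (StrongDual 𝕜 X)) (hconv : Convex ℝ C)
    (h : ∀ δ : ℝ, 0 < δ → ∃ F : Set (StrongDual 𝕜 X), IsClosed[GInv.weakStarG G] F ∧
      Metric.closedBall 0 δ ∩ C = Metric.closedBall 0 δ ∩ F) :
    IsClosed[GInv.weakStarG G] C := by
  have : CompleteSpace (GInv.fixedSubmodule G) := hG.completeSpace_coe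
  rw [GInv.weakStarG_eq_weakStarOn] at h ⊢
  exact GInv.isClosed_weakStarOn_of_convex hconv h

theorem mainTheorem5 {𝕜 : Type*} [RCLike 𝕜] {X : Type*} [NormedAddCommGroup X]
    [NormedSpace 𝕜 X] [CompleteSpace X]
    (G : Subgroup (X ≃ₗᵢ[𝕜] X)) (hG : GInv.IsCompactGroup G)
    (C : Set (StrongDual 𝕜 X)) (hconv : Convex ℝ C) (hinv : GInv.IsDualInvariant G C) :
    ((∀ δ : ℝ, 0 < δ → IsClosed[GInv.weakStarG G] (Metric.closedBall 0 δ ∩ C)) →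
      IsClosed[GInv.weakStarG G] C) ∧
    ((∀ δ : ℝ, 0 < δ → ∃ F : Set (StrongDual 𝕜 X), IsClosed[GInv.weakStarG G] F ∧
        Metric.closedBall 0 δ ∩ C = Metric.closedBall 0 δ ∩ F) →
      IsClosed[GInv.weakStarG G] C) := by
  have hclosed := mainTheorem5_general G (GInv.isClosed_fixedPoints G).isComplete C hconv
  exact ⟨fun h => hclosed fun δ hδ => ⟨_, h δ hδ, inf_left_idem _ _ |>.symm⟩, hclosed⟩
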